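/- For integers $k_1,k_2$, let $$\mathrm{Li}^{\text{sh}}_{k_1,k_2}(z_1,z_2)=\sum_{\ell_1,\ell_2=1}^{\infty}\frac{z_1^{\ell_1}z_2^{\ell_2}}{\ell_1^{k_1}(\ell_1+\ell_2)^{k_2}},$$ and let the double-indexed poly-Bernoulli numbers $\mathbb{B}_{n_1,n_2}^{(k_1,k_2)}\in\mathbb{Q}$ ($n_1,n_2\ge 0$) be defined by the (formal power series) generating function $$\frac{\mathrm{Li}^{\text{sh}}_{k_1,k_2}\bigl(1-e^{-x_1-x_2},\,1-e^{-x_2}\bigr)}{(1-e^{-x_1-x_2})(1-e^{-x_2})}=\sum_{n_1,n_2=0}^{\infty}\mathbb{B}_{n_1,n_2}^{(k_1,k_2)}\frac{x_1^{n_1}x_2^{n_2}}{n_1!\,n_2!}.$$ **Theorem.** Let $k_1,k_2,N$ be positive integers. Let $p$ be a prime number and let $n_1,n_2,m_1,m_2\ge N$ be integers with $n_1\equiv m_1 \pmod{p^{N-1}(p-1)}$ and $n_2\equiv m_2\pmod{p^{N-1}(p-1)}$. Then $\mathbb{B}_{n_1,n_2}^{(-k_1,-k_2)}$, $\mathbb{B}_{n_1,m_2}^{(-k_1,-k_2)}$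 and $\mathbb{B}_{m_1,n_2}^{(-k_1,-k_2)}$ are integers, and $$\mathbb{B}_{n_1,n_2}^{(-k_1,-k_2)}\equiv\mathbb{B}_{n_1,m_2}^{(-k_1,-k_2)}\pmod{p^N},\qquad \mathbb{B}_{n_1,n_2}^{(-k_1,-k_2)}\equiv\mathbb{B}_{m_1,n_2}^{(-k_1,-k_2)}\pmod{p^N}.$$ -/

import Mathlib

noncomputable section

namespace DoublePolyBernoulli

/-- The double polylogarithm of shuffle type with integer indices `k₁, k₂`, as a formal power
series in `z₁ = X 0`, `z₂ = X 1`: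
`∑_{l₁, l₂ ≥ 1} z₁ ^ l₁ * z₂ ^ l₂ / (l₁ ^ k₁ * (l₁ + l₂) ^ k₂)`
(equivalently `∑_{1 ≤ m₁ < m₂} z₁ ^ m₁ * z₂ ^ (m₂ - m₁) / (m₁ ^ k₁ * m₂ ^ k₂)`). -/
def shuffleLi (k₁ k₂ : ℤ) : MvPowerSeries (Fin 2) ℚ := fun l =>
  if 1 ≤ l 0 ∧ 1 ≤ l 1 then 1 / ((l 0 : ℚ) ^ k₁ * ((l 0 : ℚ) + (l 1 : ℚ)) ^ k₂) else 0

/-- The power series `Li(z₁, z₂) / (z₁ * z₂)`, that is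
`∑_{l₁, l₂ ≥ 1} z₁ ^ (l₁ - 1) * z₂ ^ (l₂ - 1) / (l₁ ^ k₁ * (l₁ + l₂) ^ k₂)`, with the summation
indices shifted to start at `0`; see `X_mul_X_mul_shuffleLiDiv`. -/
def shuffleLiDiv (k₁ k₂ : ℤ) : MvPowerSeries (Fin 2) ℚ := fun l =>
  1 / (((l 0 : ℚ) + 1) ^ k₁ * ((l 0 : ℚ) + (l 1 : ℚ) + 2) ^ k₂)

/-- The pair `(1 - exp (-x₁ - x₂), 1 - exp (-x₂))` of formal power series in `x₁ = X 0`,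
`x₂ = X 1`. -/
def expArg : Fin 2 → MvPowerSeries (Fin 2) ℚ :=
  ![1 - (PowerSeries.exp ℚ).subst (-MvPowerSeries.X 0 - MvPowerSeries.X 1 : MvPowerSeries (Fin 2) ℚ),
    1 - (PowerSeries.exp ℚ).subst (-MvPowerSeries.X 1 : MvPowerSeries (Fin 2) ℚ)]

/-- The generating function
`F(x₁, x₂) = Li(1 - exp (-x₁ - x₂), 1 - exp (-x₂)) / ((1 - exp (-x₁ - x₂)) * (1 - exp (-x₂)))`
`= ∑_{l₁, l₂ ≥ 1} (1 - exp (-x₁ - x₂)) ^ (l₁ - 1) * (1 - exp (-x₂)) ^ (l₂ - 1)`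
`/ (l₁ ^ k₁ * (l₁ + l₂) ^ k₂)`.
That it is the quotient in the first line is `genFun_eq_iff`. -/
def genFun (k₁ k₂ : ℤ) : MvPowerSeries (Fin 2) ℚ := (shuffleLiDiv k₁ k₂).subst expArg

/-- The double-indexed poly-Bernoulli number `𝔹_{n₁, n₂}^{(k₁, k₂)}` for integers `k₁, k₂`:
`F(x₁, x₂) = ∑ 𝔹_{n₁, n₂}^{(k₁, k₂)} * x₁ ^ n₁ * x₂ ^ n₂ / (n₁! * n₂!)`. -/
def polyBernoulli (k₁ k₂ : ℤ) (n₁ n₂ : ℕ) : ℚ :=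
  (n₁.factorial : ℚ) * (n₂.factorial : ℚ) *
    MvPowerSeries.coeff (Finsupp.single 0 n₁ + Finsupp.single 1 n₂) (genFun k₁ k₂)

lemma X_mul_X_mul_shuffleLiDiv (k₁ k₂ : ℤ) :
    MvPowerSeries.X 0 * MvPowerSeries.X 1 * shuffleLiDiv k₁ k₂ = shuffleLi k₁ k₂ := by
  classical
  ext l
  have hX : (MvPowerSeries.X 0 * MvPowerSeries.X 1 : MvPowerSeries (Fin 2) ℚ) =
      MvPowerSeries.monomial (Finsupp.single 0 1 + Finsupp.single 1 1) 1 := by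
    simp [MvPowerSeries.X, MvPowerSeries.monomial_mul_monomial]
  have hle : (Finsupp.single 0 1 + Finsupp.single 1 1 : Fin 2 →₀ ℕ) ≤ l ↔
      1 ≤ l 0 ∧ 1 ≤ l 1 := by
    rw [Finsupp.le_def]
    simp [Fin.forall_fin_two]
  rw [hX, MvPowerSeries.coeff_monomial_mul]
  simp only [hle, one_mul]
  change (if _ then shuffleLiDiv k₁ k₂ _ else 0) = shuffleLi k₁ k₂ l
  unfold shuffleLi shuffleLiDiv
  split_ifs with h
  · obtain ⟨h0, h1⟩ := h
    simp [Nat.cast_sub h0, Nat.cast_sub h1]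
    ring_nf
    exact Or.inl trivial
  · rfl

lemma hasSubst_neg_X_sub_X :
    PowerSeries.HasSubst (-MvPowerSeries.X 0 - MvPowerSeries.X 1 : MvPowerSeries (Fin 2) ℚ) :=
  PowerSeries.HasSubst.of_constantCoeff_zero (by simp)

lemma hasSubst_neg_X : PowerSeries.HasSubst (-MvPowerSeries.X 1 : MvPowerSeries (Fin 2) ℚ) :=
  PowerSeries.HasSubst.of_constantCoeff_zero (by simp)

lemma constantCoeff_exp_subst {a : MvPowerSeries (Fin 2) ℚ}
    (ha : MvPowerSeries.constantCoeff a = 0) :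
    MvPowerSeries.constantCoeff ((PowerSeries.exp ℚ).subst a) = 1 := by
  have h := PowerSeries.constantCoeff_subst_eq_zero ha (PowerSeries.exp ℚ - 1) (by simp)
  have hs := PowerSeries.HasSubst.of_constantCoeff_zero ha
  have h1 : (1 : PowerSeries ℚ).subst a = (1 : MvPowerSeries (Fin 2) ℚ) := by
    rw [← PowerSeries.coe_substAlgHom hs, map_one]
  rw [PowerSeries.subst_sub hs, h1, map_sub, map_one, sub_eq_zero] at h
  exact h

lemma hasSubst_expArg : MvPowerSeries.HasSubst expArg := by
  apply MvPowerSeries.hasSubst_of_constantCoeff_zero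
  intro i
  fin_cases i
  · simp [expArg, constantCoeff_exp_subst]
  · simp [expArg, constantCoeff_exp_subst]

lemma eq_zero_of_exp_subst_eq_one {a : MvPowerSeries (Fin 2) ℚ}
    (ha : MvPowerSeries.constantCoeff a = 0) (h : (PowerSeries.exp ℚ).subst a = 1) : a = 0 := by
  have hs := PowerSeries.HasSubst.of_constantCoeff_zero ha
  have h1 : (1 : PowerSeries ℚ).subst a = (1 : MvPowerSeries (Fin 2) ℚ) := by
    rw [← PowerSeries.coe_substAlgHom hs, map_one]
  have hP0 : PowerSeries.constantCoeff (PowerSeries.exp ℚ - 1) = 0 := by simp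
  have hPa : (PowerSeries.exp ℚ - 1).subst a = 0 := by
    rw [PowerSeries.subst_sub hs, h1, h, sub_self]
  have hu : IsUnit (PowerSeries.coeff 1 (PowerSeries.exp ℚ - 1)) := by
    simp [PowerSeries.coeff_exp, PowerSeries.coeff_one]
  set P := PowerSeries.exp ℚ - 1 with hP
  have hinv := PowerSeries.subst_substInvOfIsUnit_left P hP0 hu
  have hc := PowerSeries.subst_comp_subst_apply
    (PowerSeries.HasSubst.of_constantCoeff_zero' hP0) hs (P.substInvOfIsUnit hu)
  rw [hinv, PowerSeries.subst_X hs, hPa, PowerSeries.subst_zero_of_constantCoeff_zero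
    (PowerSeries.constantCoeff_substInvOfIsUnit P hu)] at hc
  exact hc

lemma expArg_ne_zero (i : Fin 2) : expArg i ≠ 0 := by
  intro h
  have key : ∀ a : MvPowerSeries (Fin 2) ℚ, MvPowerSeries.constantCoeff a = 0 →
      MvPowerSeries.coeff (Finsupp.single 1 1) a = -1 →
      (1 - (PowerSeries.exp ℚ).subst a : MvPowerSeries (Fin 2) ℚ) ≠ 0 := by
    intro a ha hc h
    rw [eq_zero_of_exp_subst_eq_one ha (sub_eq_zero.mp h).symm] at hc
    simp at hc
  fin_cases i
  · exact key _ (by simp) (by simp [MvPowerSeries.coeff_X, Finsupp.single_left_inj]) h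
  · exact key _ (by simp) (by simp [MvPowerSeries.coeff_X]) h

/-- `genFun k₁ k₂` is the one and only power series `F` with
`(1 - exp (-x₁ - x₂)) * (1 - exp (-x₂)) * F = Li(1 - exp (-x₁ - x₂), 1 - exp (-x₂))`. -/
lemma genFun_eq_iff (k₁ k₂ : ℤ) (F : MvPowerSeries (Fin 2) ℚ) :
    F = genFun k₁ k₂ ↔ expArg 0 * expArg 1 * F = (shuffleLi k₁ k₂).subst expArg := by
  have h : (shuffleLi k₁ k₂).subst expArg = expArg 0 * expArg 1 * genFun k₁ k₂ := by
    rw [← X_mul_X_mul_shuffleLiDiv, MvPowerSeries.subst_mul hasSubst_expArg,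
      MvPowerSeries.subst_mul hasSubst_expArg, MvPowerSeries.subst_X hasSubst_expArg,
      MvPowerSeries.subst_X hasSubst_expArg, genFun]
  rw [h, mul_right_inj' (mul_ne_zero (expArg_ne_zero 0) (expArg_ne_zero 1))]

end DoublePolyBernoulli

end

/-! For negative indices, `Li(z₁, z₂) / (z₁ * z₂)` has polynomial coefficients, so it is rational:
an integral combination of `(1 - z₁) ^ (-i - 1) * (1 - z₂) ^ (-j - 1)`
(`shuffleLiDiv_mem_geomSpan`). The substitution turns `1 - z₁` and `1 - z₂` into `exp (-x₁ - x₂)`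
and `exp (-x₂)`, hence the generating function into a finite integral combination of exponentials
`exp (a * x₁ + b * x₂)` with natural `a`, `b` (`subst_expArg_mem_expSpan`). Each number is therefore
a sum of terms `c * a ^ n₁ * b ^ n₂` with `c`, `a`, `b` independent of `n₁`, `n₂`. Integrality is
immediate, and the congruences follow termwise from Euler's theorem. -/

open PowerSeries in
/-- The coefficients of `f(X₀) * g(X₁)`. -/
lemma coeff_subst_X_zero_mul_subst_X_one {R : Type*} [CommRing R] (f g : PowerSeries R)
    (e : Fin 2 →₀ ℕ) :
    MvPowerSeries.coeff e (f.subst (MvPowerSeries.X 0 : MvPowerSeries (Fin 2) R) *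
      g.subst (MvPowerSeries.X 1 : MvPowerSeries (Fin 2) R)) = coeff (e 0) f * coeff (e 1) g := by
  rw [MvPowerSeries.coeff_mul,
    Finset.sum_eq_single (Finsupp.single 0 (e 0), Finsupp.single 1 (e 1)) ?_ ?_]
  · simp [coeff_subst_single]
  · intro b hb hb'
    by_contra hne
    obtain ⟨h0, h1⟩ := ne_zero_and_ne_zero_of_mul hne
    simp only [coeff_subst_single, ne_eq, ite_eq_right_iff, not_forall, exists_prop] at h0 h1
    apply hb'
    rw [Prod.ext_iff, ← Finset.HasAntidiagonal.mem_antidiagonal.mp hb, h0.1, h1.1]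
    simp
  · intro he
    refine absurd (Finset.HasAntidiagonal.mem_antidiagonal.mpr ?_) he
    ext i
    fin_cases i <;> simp

namespace DoublePolyBernoulli

open PowerSeries (HasSubst)

/-! ### Geometric and exponential building blocks -/

/-- The power series `(1 - X s)⁻¹`. -/
noncomputable def geomX (s : Fin 2) : MvPowerSeries (Fin 2) ℚ :=
  (PowerSeries.mk 1 : PowerSeries ℚ).subst (MvPowerSeries.X s : MvPowerSeries (Fin 2) ℚ)

/-- The power series `exp (X s)`. -/
noncomputable def expX (s : Fin 2) : MvPowerSeries (Fin 2) ℚ :=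
  (PowerSeries.exp ℚ).subst (MvPowerSeries.X s : MvPowerSeries (Fin 2) ℚ)

lemma coeff_geomX_pow_mul_geomX_pow (i j : ℕ) (e : Fin 2 →₀ ℕ) :
    MvPowerSeries.coeff e (geomX 0 ^ (i + 1) * geomX 1 ^ (j + 1)) =
      ((i + e 0).choose i : ℚ) * ((j + e 1).choose j : ℚ) := by
  rw [geomX, geomX, ← PowerSeries.subst_pow (HasSubst.X 0), ← PowerSeries.subst_pow (HasSubst.X 1),
    coeff_subst_X_zero_mul_subst_X_one, PowerSeries.mk_one_pow_eq_mk_choose_add,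
    PowerSeries.mk_one_pow_eq_mk_choose_add, PowerSeries.coeff_mk, PowerSeries.coeff_mk]

lemma factorial_mul_coeff_expX_pow_mul_expX_pow (a b n m : ℕ) :
    (n.factorial : ℚ) * (m.factorial : ℚ) *
      MvPowerSeries.coeff (Finsupp.single 0 n + Finsupp.single 1 m) (expX 0 ^ a * expX 1 ^ b) =
      (a : ℚ) ^ n * (b : ℚ) ^ m := by
  rw [expX, expX, ← PowerSeries.subst_pow (HasSubst.X 0), ← PowerSeries.subst_pow (HasSubst.X 1),
    coeff_subst_X_zero_mul_subst_X_one, PowerSeries.exp_pow_eq_rescale_exp,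
    PowerSeries.exp_pow_eq_rescale_exp]
  have hn : (n.factorial : ℚ) ≠ 0 := by positivity
  have hm : (m.factorial : ℚ) ≠ 0 := by positivity
  simp [PowerSeries.coeff_rescale, PowerSeries.coeff_exp]
  field_simp

/-- The integral combinations of the series `(1 - X₀) ^ (-i - 1) * (1 - X₁) ^ (-j - 1)`. -/
noncomputable def geomSpan : Submodule ℤ (MvPowerSeries (Fin 2) ℚ) :=
  Submodule.span ℤ (Set.range fun q : ℕ × ℕ => geomX 0 ^ (q.1 + 1) * geomX 1 ^ (q.2 + 1))

/-- The integral combinations of the series `exp (a * X₀ + b * X₁)`. -/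
noncomputable def expSpan : Submodule ℤ (MvPowerSeries (Fin 2) ℚ) :=
  Submodule.span ℤ (Set.range fun q : ℕ × ℕ => expX 0 ^ q.1 * expX 1 ^ q.2)

/-! ### Rationality of the shuffle series at negative indices -/

/-- Multiplication of the coefficient of index `l` by `w l`. -/
def weight (w : (Fin 2 →₀ ℕ) → ℚ) : MvPowerSeries (Fin 2) ℚ →ₗ[ℤ] MvPowerSeries (Fin 2) ℚ where
  toFun f := fun l => w l * f l
  map_add' f g := by
    funext l
    exact mul_add _ _ _
  map_smul' c f := by
    funext l
    exact mul_smul_comm c (w l) (f l)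

lemma coeff_weight (w : (Fin 2 →₀ ℕ) → ℚ) (f : MvPowerSeries (Fin 2) ℚ) (l : Fin 2 →₀ ℕ) :
    MvPowerSeries.coeff l (weight w f) = w l * MvPowerSeries.coeff l f := rfl

/-- Write `n + 1 = (i + n + 1) - i` and absorb the first factor into the binomial coefficient. -/
lemma add_one_mul_choose (i n : ℕ) :
    ((n : ℚ) + 1) * ((i + n).choose i : ℚ) =
      (i + 1 : ℚ) * ((i + 1 + n).choose (i + 1) : ℚ) - i * ((i + n).choose i : ℚ) := by
  have h := Nat.add_one_mul_choose_eq (i + n) i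
  rw [show i + n + 1 = i + 1 + n by ring] at h
  have h' : ((i + 1 + n : ℕ) : ℚ) * ((i + n).choose i : ℚ) =
    ((i + 1 + n).choose (i + 1) : ℚ) * ((i + 1 : ℕ) : ℚ) := by exact_mod_cast h
  push_cast at h'
  linear_combination h'

/-- This weight is the operator `f ↦ ∂ₛ(Xₛ * f)`, which sends `(1 - X) ^ (-i - 1)` to `(i + 1) * (1
- X) ^ (-i - 2) - i * (1 - X) ^ (-i - 1)`. -/
lemma weight_mem_geomSpan (s : Fin 2) {f : MvPowerSeries (Fin 2) ℚ} (hf : f ∈ geomSpan) :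
    weight (fun l => (l s : ℚ) + 1) f ∈ geomSpan := by
  suffices geomSpan ≤ geomSpan.comap (weight fun l => (l s : ℚ) + 1) from this hf
  refine Submodule.span_le.mpr ?_
  rintro _ ⟨⟨i, j⟩, rfl⟩
  have hmem (i j : ℕ) : geomX 0 ^ (i + 1) * geomX 1 ^ (j + 1) ∈ geomSpan :=
    Submodule.subset_span ⟨(i, j), rfl⟩
  simp only [SetLike.mem_coe, Submodule.mem_comap]
  fin_cases s
  · convert Submodule.sub_mem _ (Submodule.smul_mem _ ((i : ℤ) + 1) (hmem (i + 1) j))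
      (Submodule.smul_mem _ (i : ℤ) (hmem i j)) using 1
    ext l
    simp only [coeff_weight, map_sub, map_zsmul, coeff_geomX_pow_mul_geomX_pow]
    simp only [zsmul_eq_mul]
    push_cast
    linear_combination ((j + l 1).choose j : ℚ) * add_one_mul_choose i (l 0)
  · convert Submodule.sub_mem _ (Submodule.smul_mem _ ((j : ℤ) + 1) (hmem i (j + 1)))
      (Submodule.smul_mem _ (j : ℤ) (hmem i j)) using 1
    ext l
    simp only [coeff_weight, map_sub, map_zsmul, coeff_geomX_pow_mul_geomX_pow]
    simp only [zsmul_eq_mul]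
    push_cast
    linear_combination ((i + l 0).choose i : ℚ) * add_one_mul_choose j (l 1)

lemma shuffleLiDiv_zero_zero : shuffleLiDiv 0 0 = geomX 0 * geomX 1 := by
  ext l
  have h := coeff_geomX_pow_mul_geomX_pow 0 0 l
  simp only [zero_add, pow_one, Nat.choose_zero_right, Nat.cast_one, mul_one] at h
  rw [h]
  change 1 / (_ * _) = (1 : ℚ)
  simp

lemma shuffleLiDiv_neg_succ_left (k : ℕ) (k₂ : ℤ) :
    shuffleLiDiv (-((k + 1 : ℕ) : ℤ)) k₂ =
      weight (fun l => (l 0 : ℚ) + 1) (shuffleLiDiv (-(k : ℤ)) k₂) := by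
  funext l
  change 1 / (_ * _) = ((l 0 : ℚ) + 1) * (1 / (_ * _))
  simp only [zpow_neg, zpow_natCast, pow_succ, one_div, mul_inv, inv_inv]
  ring

lemma shuffleLiDiv_neg_succ_right (k : ℕ) (k₁ : ℤ) :
    shuffleLiDiv k₁ (-((k + 1 : ℕ) : ℤ)) =
      weight (fun l => (l 0 : ℚ) + 1) (shuffleLiDiv k₁ (-(k : ℤ))) +
        weight (fun l => (l 1 : ℚ) + 1) (shuffleLiDiv k₁ (-(k : ℤ))) := by
  funext l
  change 1 / (_ * _) = ((l 0 : ℚ) + 1) * (1 / (_ * _)) + ((l 1 : ℚ) + 1) * (1 / (_ * _))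
  simp only [zpow_neg, zpow_natCast, pow_succ, one_div, mul_inv, inv_inv]
  ring

lemma shuffleLiDiv_mem_geomSpan (k₁ k₂ : ℕ) :
    shuffleLiDiv (-(k₁ : ℤ)) (-(k₂ : ℤ)) ∈ geomSpan := by
  induction k₂ with
  | zero =>
    induction k₁ with
    | zero =>
      simp only [Nat.cast_zero, neg_zero, shuffleLiDiv_zero_zero]
      exact Submodule.subset_span ⟨(0, 0), by simp⟩
    | succ k ih =>
      rw [shuffleLiDiv_neg_succ_left]
      exact weight_mem_geomSpan 0 ih
  | succ k ih =>
    rw [shuffleLiDiv_neg_succ_right]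
    exact Submodule.add_mem _ (weight_mem_geomSpan 0 ih) (weight_mem_geomSpan 1 ih)

/-! ### From geometric series to exponentials -/

lemma subst_evalNegHom {a : MvPowerSeries (Fin 2) ℚ} (ha : HasSubst a) (f : PowerSeries ℚ) :
    (PowerSeries.evalNegHom f).subst a = f.subst (-a) := by
  have hX : HasSubst ((-1 : ℚ) • PowerSeries.X : PowerSeries ℚ) := HasSubst.smul_X' _
  rw [PowerSeries.evalNegHom, PowerSeries.rescale_eq_subst,
    PowerSeries.subst_comp_subst_apply hX ha, PowerSeries.subst_smul ha, PowerSeries.subst_X ha,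
    neg_one_smul]

lemma exp_subst_mul_exp_subst_neg {a : MvPowerSeries (Fin 2) ℚ} (ha : HasSubst a) :
    (PowerSeries.exp ℚ).subst a * (PowerSeries.exp ℚ).subst (-a) = 1 := by
  rw [← subst_evalNegHom ha, ← PowerSeries.subst_mul ha, PowerSeries.exp_mul_exp_neg_eq_one,
    ← PowerSeries.coe_substAlgHom ha, map_one]

lemma exp_subst_X_add_X :
    (PowerSeries.exp ℚ).subst (MvPowerSeries.X 0 + MvPowerSeries.X 1 : MvPowerSeries (Fin 2) ℚ) =
      expX 0 * expX 1 := by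
  ext e
  rw [PowerSeries.coeff_subst_X_zero_add_X_one, expX, expX, coeff_subst_X_zero_mul_subst_X_one]
  simp only [PowerSeries.coeff_exp, Algebra.algebraMap_self, RingHom.id_apply]
  have h := Nat.choose_mul_factorial_mul_factorial (Nat.le_add_right (e 0) (e 1))
  rw [Nat.add_sub_cancel_left] at h
  have h' : ((e 0 + e 1).choose (e 0) : ℚ) * (e 0).factorial * (e 1).factorial =
    (e 0 + e 1).factorial := by exact_mod_cast h
  rw [← h']
  have h0 : ((e 0).factorial : ℚ) ≠ 0 := by positivity
  have h1 : ((e 1).factorial : ℚ) ≠ 0 := by positivity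
  have h2 : ((e 0 + e 1).choose (e 0) : ℚ) ≠ 0 := by
    exact_mod_cast (Nat.choose_pos (Nat.le_add_right _ _)).ne'
  field_simp

lemma geomX_subst_mul (s : Fin 2) : (geomX s).subst expArg * (1 - expArg s) = 1 := by
  have h : geomX s * (1 - MvPowerSeries.X s) = 1 := by
    have h := congrArg (PowerSeries.substAlgHom (HasSubst.X (S := ℚ) s))
      (PowerSeries.mk_one_mul_one_sub_eq_one ℚ)
    rwa [map_mul, map_sub, map_one, PowerSeries.substAlgHom_X, PowerSeries.coe_substAlgHom] at h
  have h' := congrArg (MvPowerSeries.substAlgHom (R := ℚ) hasSubst_expArg) h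
  rwa [map_mul, map_sub, map_one, MvPowerSeries.substAlgHom_X,
    MvPowerSeries.coe_substAlgHom] at h'

lemma geomX_zero_subst : (geomX 0).subst expArg = expX 0 * expX 1 := by
  have h := geomX_subst_mul 0
  have he : 1 - expArg 0 = (PowerSeries.exp ℚ).subst
      (-(MvPowerSeries.X 0 + MvPowerSeries.X 1) : MvPowerSeries (Fin 2) ℚ) := by
    rw [neg_add']
    simp [expArg]
  rw [he] at h
  rw [← exp_subst_X_add_X]
  exact left_inv_eq_right_inv h ((mul_comm _ _).trans
    (exp_subst_mul_exp_subst_neg ((HasSubst.X 0).add (HasSubst.X 1))))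

lemma geomX_one_subst : (geomX 1).subst expArg = expX 1 := by
  have h := geomX_subst_mul 1
  have he : 1 - expArg 1 = (PowerSeries.exp ℚ).subst
      (-MvPowerSeries.X 1 : MvPowerSeries (Fin 2) ℚ) := by
    simp [expArg]
  rw [he] at h
  exact left_inv_eq_right_inv h ((mul_comm _ _).trans
    (exp_subst_mul_exp_subst_neg (HasSubst.X 1)))

lemma subst_expArg_mem_expSpan {f : MvPowerSeries (Fin 2) ℚ} (hf : f ∈ geomSpan) :
    f.subst expArg ∈ expSpan := by
  rw [← MvPowerSeries.coe_substAlgHom hasSubst_expArg]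
  suffices geomSpan ≤ expSpan.comap
    ((MvPowerSeries.substAlgHom (R := ℚ) hasSubst_expArg).toLinearMap.restrictScalars ℤ) from
      this hf
  refine Submodule.span_le.mpr ?_
  rintro _ ⟨⟨i, j⟩, rfl⟩
  -- `exp X₁` occurs in the images of both geometric series, so its exponent is `(i + 1) + (j + 1)`.
  refine Submodule.subset_span ⟨(i + 1, i + j + 2), ?_⟩
  simp only [LinearMap.coe_restrictScalars, AlgHom.toLinearMap_apply, map_mul, map_pow]
  rw [MvPowerSeries.coe_substAlgHom, geomX_zero_subst, geomX_one_subst]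
  ring

/-- The poly-Bernoulli numbers with negative indices are integral combinations of the numbers
`a ^ n * b ^ m`, with coefficients that do not depend on `n` and `m`. -/
lemma exists_polyBernoulli_eq_sum (k₁ k₂ : ℕ) : ∃ c : ℕ × ℕ →₀ ℤ, ∀ n m : ℕ,
    polyBernoulli (-(k₁ : ℤ)) (-(k₂ : ℤ)) n m =
      ((∑ q ∈ c.support, c q * ((q.1 : ℤ) ^ n * (q.2 : ℤ) ^ m) : ℤ) : ℚ) := by
  have h : genFun (-(k₁ : ℤ)) (-(k₂ : ℤ)) ∈ expSpan :=
    subst_expArg_mem_expSpan (shuffleLiDiv_mem_geomSpan k₁ k₂)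
  obtain ⟨c, hc⟩ := Finsupp.mem_span_range_iff_exists_finsupp.mp h
  refine ⟨c, fun n m => ?_⟩
  rw [polyBernoulli, ← hc, Finsupp.sum, map_sum, Finset.mul_sum]
  push_cast
  refine Finset.sum_congr rfl fun q _ => ?_
  rw [← factorial_mul_coeff_expX_pow_mul_expX_pow, map_zsmul, zsmul_eq_mul]
  ring

end DoublePolyBernoulli

/-! ### Congruences modulo prime powers -/

/-- Euler's congruence for all bases, with exponents at least `N`. -/
lemma Int.pow_modEq_pow_of_modEq_totient {p N n m : ℕ} (hp : p.Prime) (hN : 0 < N) (hn : N ≤ n)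
    (hm : N ≤ m) (h : n ≡ m [MOD p ^ (N - 1) * (p - 1)]) (x : ℕ) :
    (x : ℤ) ^ n ≡ (x : ℤ) ^ m [ZMOD (p : ℤ) ^ N] := by
  wlog hnm : n ≤ m generalizing n m
  · exact (this hm hn h.symm (le_of_not_ge hnm)).symm
  suffices x ^ n ≡ x ^ m [MOD p ^ N] by
    exact_mod_cast (Int.natCast_modEq_iff.mpr this)
  -- If `p ∣ x`, both powers vanish modulo `p ^ N` because the exponents are at least `N`; otherwise
  -- `x` is a unit and Euler's theorem applies.
  by_cases hx : p ∣ x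
  · have hz {t : ℕ} (ht : N ≤ t) : x ^ t ≡ 0 [MOD p ^ N] :=
      (Nat.modEq_zero_iff_dvd).mpr ((pow_dvd_pow_of_dvd hx N).trans (pow_dvd_pow x ht))
    exact (hz hn).trans (hz hm).symm
  · have hco : Nat.Coprime x (p ^ N) :=
      Nat.Coprime.pow_right N ((Nat.Prime.coprime_iff_not_dvd hp).mpr hx).symm
    obtain ⟨t, ht⟩ := (Nat.modEq_iff_dvd' hnm).mp h
    rw [← Nat.totient_prime_pow hp hN] at ht
    obtain rfl : m = n + (p ^ N).totient * t := by omega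
    have h1 : x ^ ((p ^ N).totient * t) ≡ 1 [MOD p ^ N] := by
      simpa [pow_mul] using (Nat.ModEq.pow_totient hco).pow t
    simpa [pow_add] using (h1.mul_left (x ^ n)).symm

theorem theorem2p2 (k₁ k₂ N p n₁ n₂ m₁ m₂ : ℕ) (hk₁ : 0 < k₁) (hk₂ : 0 < k₂) (hN : 0 < N)
    (hp : p.Prime) (hn₁ : N ≤ n₁) (hn₂ : N ≤ n₂) (hm₁ : N ≤ m₁) (hm₂ : N ≤ m₂)
    (h₁ : n₁ ≡ m₁ [MOD p ^ (N - 1) * (p - 1)]) (h₂ : n₂ ≡ m₂ [MOD p ^ (N - 1) * (p - 1)]) :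
    ∃ a b c : ℤ,
      DoublePolyBernoulli.polyBernoulli (-(k₁ : ℤ)) (-(k₂ : ℤ)) n₁ n₂ = (a : ℚ) ∧
      DoublePolyBernoulli.polyBernoulli (-(k₁ : ℤ)) (-(k₂ : ℤ)) n₁ m₂ = (b : ℚ) ∧
      DoublePolyBernoulli.polyBernoulli (-(k₁ : ℤ)) (-(k₂ : ℤ)) m₁ n₂ = (c : ℚ) ∧
      a ≡ b [ZMOD (p : ℤ) ^ N] ∧ a ≡ c [ZMOD (p : ℤ) ^ N] := by

  obtain ⟨c, hc⟩ := DoublePolyBernoulli.exists_polyBernoulli_eq_sum k₁ k₂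
  refine ⟨_, _, _, hc n₁ n₂, hc n₁ m₂, hc m₁ n₂, ?_, ?_⟩
  · exact Int.ModEq.sum fun q _ => ((Int.pow_modEq_pow_of_modEq_totient hp hN hn₂ hm₂ h₂
      q.2).mul_left _).mul_left _
  · exact Int.ModEq.sum fun q _ => ((Int.pow_modEq_pow_of_modEq_totient hp hN hn₁ hm₁ h₁
      q.1).mul_right _).mul_left _
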